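/- Let $n\ge 1$. For $k\in\{1,\dots,n\}$ let $Q(k,n)$ be the set of increasing sequences of $k$ elements of $\{1,\dots,n\}$. For $A\in\mathbb{R}^{n\times n}$, the $k$-multiplicative compound $A^{(k)}$ is the $\binom nk\times\binom nk$ matrix, indexed by $Q(k,n)$, of all $k$-minors of $A$, that is, $(A^{(k)})_{\alpha\beta}=\det A[\alpha|\beta]$, where $A[\alpha|\beta]$ is the submatrix of $A$ with rows $\alpha$ and columns $\beta$; the $k$-additive compound is $A^{[k]}:=\frac{d}{d\varepsilon}(I_n+\varepsilon A)^{(k)}\big|_{\varepsilon=0}$. A norm $|\cdot|$ on $\mathbb{R}^m$ induces the matrix norm $\|B\|:=\max_{|x|=1}|Bx|$ and the logarithmic norm $\mu(B):=\lim_{\varepsilon\downarrow 0}\frac{\|I+\varepsilon B\|-1}{\varepsilon}$ on $\mathbb{R}^{m\times m}$. For $p\in\{1,2,\infty\}$ and an invertible $H\in\mathbb{R}^{m\times m}$, let $\mu_{p,H}$ denote the logarithmic norm induced by the scaled $L_p$ norm $x\mapsto|Hx|_p$. Let $A\in\mathbb{R}^{n\times n}$, let $T\in\mathbb{R}^{n\times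 n}$ be invertible, let $p\in\{1,2,\infty\}$, and let $k,\ell\in\{1,\dots,n\}$ with $\ell\le k$. Then $$\frac1k\,\mu_{p,T^{(k)}}\big(A^{[k]}\big)\le\frac1\ell\,\mu_{p,T^{(\ell)}}\big(A^{[\ell]}\big).$$ In particular, $\mu_{p,T^{(k)}}(A^{[k]})\le k\,\mu_{p,T}(A)$. -/

import Mathlib

open Filter Topology
open scoped ENNReal

namespace CompoundMatrix

/-- `Q k n`: the increasing sequences of `k` elements of an `n`-element index set. -/
abbrev Q (k n : ℕ) : Type := Fin k ↪o Fin n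

/-- The `k`-multiplicative compound `A^{(k)}`: the matrix of all `k`-minors
`A(α|β) = det A[α|β]`, with rows and columns indexed by increasing sequences. -/
def mulCompound {R : Type*} [CommRing R] {n m : ℕ} (k : ℕ) (A : Matrix (Fin n) (Fin m) R) :
    Matrix (Q k n) (Q k m) R :=
  Matrix.of fun α β => (A.submatrix α β).det

/-- The `k`-additive compound `A^{[k]}`: the (entrywise) derivative at `ε = 0` of
`(I + ε A)^{(k)}`. -/
noncomputable def addCompound {𝕜 : Type*} [NontriviallyNormedField 𝕜] {n : ℕ} (k : ℕ)
    (A : Matrix (Fin n) (Fin n) 𝕜) : Matrix (Q k n) (Q k n) 𝕜 :=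
  Matrix.of fun α β => deriv (fun ε : 𝕜 => mulCompound k (1 + ε • A) α β) 0

/-- The `L_p` norm `|x|_p` of a real vector with finite index set. -/
noncomputable def lpNorm {ι : Type*} [Fintype ι] (p : ℝ≥0∞) (x : ι → ℝ) : ℝ :=
  ‖WithLp.toLp p x‖

/-- The scaled norm `|x|_H = |H x|`. -/
def scaledNorm {ι : Type*} [Fintype ι] (N : (ι → ℝ) → ℝ) (H : Matrix ι ι ℝ) (x : ι → ℝ) : ℝ :=
  N (H.mulVec x)

/-- The matrix norm `‖A‖ = max_{|x| = 1} |A x|` induced by a vector norm `N = |·|`. -/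
noncomputable def inducedNorm {ι : Type*} [Fintype ι] (N : (ι → ℝ) → ℝ) (A : Matrix ι ι ℝ) : ℝ :=
  sSup ((fun x => N (A.mulVec x)) '' {x | N x = 1})

/-- The logarithmic norm `μ(A) = lim_{ε ↓ 0} (‖I + ε A‖ - 1) / ε` induced by a vector norm `N`. -/
noncomputable def logNorm {ι : Type*} [Fintype ι] [DecidableEq ι] (N : (ι → ℝ) → ℝ)
    (A : Matrix ι ι ℝ) : ℝ :=
  limUnder (𝓝[>] (0 : ℝ)) fun ε : ℝ => (inducedNorm N (1 + ε • A) - 1) / ε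

/-- The logarithmic norm `μ_{p,T}` induced by the scaled norm `x ↦ |T x|_p`. -/
noncomputable def logNormLp {ι : Type*} [Fintype ι] [DecidableEq ι] (p : ℝ≥0∞)
    (T A : Matrix ι ι ℝ) : ℝ :=
  logNorm (scaledNorm (lpNorm p) T) A

/-- The derivative in the definition of the additive compound exists. -/
theorem hasDerivAt_mulCompound {𝕜 : Type*} [NontriviallyNormedField 𝕜] {n : ℕ} (k : ℕ)
    (A : Matrix (Fin n) (Fin n) 𝕜) (α β : Q k n) :
    HasDerivAt (fun ε : 𝕜 => mulCompound k (1 + ε • A) α β) (addCompound k A α β) 0 := by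
  apply DifferentiableAt.hasDerivAt
  simp only [mulCompound, Matrix.of_apply, Matrix.det_apply, Matrix.submatrix_apply,
    Matrix.add_apply, Matrix.smul_apply, smul_eq_mul, Units.smul_def, zsmul_eq_mul]
  fun_prop

/-- The limit in the definition of `μ_{p,T}` exists. -/
theorem tendsto_logNormLp {ι : Type*} [Fintype ι] [DecidableEq ι] [Nonempty ι] (p : ℝ≥0∞)
    (hp : 1 ≤ p) (T A : Matrix ι ι ℝ) (hT : IsUnit T) :
    Tendsto (fun ε : ℝ => (inducedNorm (scaledNorm (lpNorm p) T) (1 + ε • A) - 1) / ε)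
      (𝓝[>] (0 : ℝ)) (𝓝 (logNormLp p T A)) := by
  have : Fact (1 ≤ p) := ⟨hp⟩
  set N := scaledNorm (lpNorm p) T with hN
  have hdet : IsUnit T.det := (Matrix.isUnit_iff_isUnit_det T).1 hT
  have N_def : ∀ x, N x = ‖WithLp.toLp p (T.mulVec x)‖ := fun x => rfl
  have N_add : ∀ x y, N (x + y) ≤ N x + N y := fun x y => by
    simp only [N_def, Matrix.mulVec_add, WithLp.toLp_add]; exact norm_add_le _ _
  have N_smul : ∀ (c : ℝ) x, N (c • x) = |c| * N x := fun c x => by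
    simp only [N_def, Matrix.mulVec_smul, WithLp.toLp_smul, norm_smul, Real.norm_eq_abs]
  have hbdd : ∀ B : Matrix ι ι ℝ, BddAbove ((fun x => N (B.mulVec x)) '' {x | N x = 1}) := by
    intro B
    let L : WithLp p (ι → ℝ) →ₗ[ℝ] WithLp p (ι → ℝ) :=
      (WithLp.linearEquiv p ℝ (ι → ℝ)).symm.toLinearMap ∘ₗ
        (T * B * T⁻¹).mulVecLin ∘ₗ (WithLp.linearEquiv p ℝ (ι → ℝ)).toLinearMap
    refine ⟨‖LinearMap.toContinuousLinearMap L‖, ?_⟩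
    rintro _ ⟨x, hx, rfl⟩
    have h := (LinearMap.toContinuousLinearMap L).le_opNorm (WithLp.toLp p (T.mulVec x))
    have h1 : ‖WithLp.toLp p (T.mulVec x)‖ = 1 := hx
    rw [h1, mul_one] at h
    have e : (LinearMap.toContinuousLinearMap L) (WithLp.toLp p (T.mulVec x))
        = WithLp.toLp p (T.mulVec (B.mulVec x)) := by
      change WithLp.toLp p ((T * B * T⁻¹).mulVec (T.mulVec x)) = _
      rw [Matrix.mulVec_mulVec, Matrix.mul_assoc, Matrix.nonsing_inv_mul _ hdet, Matrix.mul_one,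
        Matrix.mulVec_mulVec]
    rw [e] at h
    exact h
  have hne : ∃ x, N x = 1 := by
    obtain ⟨i⟩ := ‹Nonempty ι›
    let y : ι → ℝ := T⁻¹.mulVec (Pi.single i 1)
    have hy : N y ≠ 0 := by
      rw [N_def, Matrix.mulVec_mulVec, Matrix.mul_nonsing_inv _ hdet, Matrix.one_mulVec]
      intro h0
      have h2 := congrFun ((WithLp.toLp_eq_zero p).1 (norm_eq_zero.1 h0)) i
      simp at h2
    refine ⟨(N y)⁻¹ • y, ?_⟩
    have hpos : 0 ≤ N y := norm_nonneg _
    rw [N_smul, abs_of_nonneg (inv_nonneg.2 hpos), inv_mul_cancel₀ hy]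
  have hne' : ∀ B : Matrix ι ι ℝ, ((fun x => N (B.mulVec x)) '' {x | N x = 1}).Nonempty :=
    fun B => Set.Nonempty.image _ hne
  have hconv : ConvexOn ℝ Set.univ (fun ε : ℝ => inducedNorm N (1 + ε • A)) := by
    refine ⟨convex_univ, ?_⟩
    intro s _ t _ a b ha hb hab
    refine csSup_le (hne' _) ?_
    rintro _ ⟨x, hx, rfl⟩
    have e : (1 + (a • s + b • t) • A).mulVec x
        = a • ((1 + s • A).mulVec x) + b • ((1 + t • A).mulVec x) := by
      have : (1 : Matrix ι ι ℝ) + (a • s + b • t) • A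
          = a • (1 + s • A) + b • (1 + t • A) := by
        rw [smul_add, smul_add, add_add_add_comm, ← add_smul, hab, one_smul, smul_smul, smul_smul,
          ← add_smul]
        simp
      rw [this, Matrix.add_mulVec, Matrix.smul_mulVec, Matrix.smul_mulVec]
    change N ((1 + (a • s + b • t) • A).mulVec x) ≤ _
    rw [e]
    refine (N_add _ _).trans ?_
    rw [N_smul, N_smul, abs_of_nonneg ha, abs_of_nonneg hb]
    exact add_le_add
      (mul_le_mul_of_nonneg_left (le_csSup (hbdd _) ⟨x, hx, rfl⟩) ha)
      (mul_le_mul_of_nonneg_left (le_csSup (hbdd _) ⟨x, hx, rfl⟩) hb)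
  have h0 : inducedNorm N (1 + (0 : ℝ) • A) = 1 := by
    have : ((fun x => N ((1 + (0 : ℝ) • A).mulVec x)) '' {x | N x = 1}) = {1} := by
      ext r
      simp only [zero_smul, add_zero, Matrix.one_mulVec, Set.mem_image, Set.mem_ofPred_eq,
        Set.mem_singleton_iff]
      constructor
      · rintro ⟨x, hx, rfl⟩; exact hx
      · rintro rfl
        obtain ⟨x, hx⟩ := hne
        exact ⟨x, hx, hx⟩
    rw [inducedNorm, this, csSup_singleton]
  have hd := (hconv.differentiableWithinAt_Ioi_of_mem_interior (x := (0 : ℝ))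
    (by simp)).hasDerivWithinAt
  rw [hasDerivWithinAt_iff_tendsto_slope' (by simp)] at hd
  refine tendsto_nhds_limUnder ⟨_, hd.congr ?_⟩
  intro ε
  rw [slope_def_field, h0, sub_zero]

end CompoundMatrix

open CompoundMatrix

/-! Vectors indexed by `Q k n` are identified with alternating functions `Z` of `k` indices. The
`L_p` norm of `Z` over all tuples is a fixed multiple of its norm over increasing ones
(`exists_lpNorm_alt_eq`), and `B^{[k]}` becomes the derivation that sums the action of `B` over the
`k` slots (`addCompound_mulVec`). Let `B` act on only `ℓ` slots and freeze the others. Each slice is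
alternating in `ℓ` indices and is moved by `I + εB^{[ℓ]}`, so the norm grows at most by `‖I +
εB^{[ℓ]}‖` (`lpNorm_add_smul_slotAction_le`). The `k` cyclic shifts of the set of `ℓ` slots cover
each slot `ℓ` times, so averaging over them gives `‖I + (ℓ/k)εB^{[k]}‖ ≤ ‖I + εB^{[ℓ]}‖`
(`inducedNorm_addCompound_le`). Subtracting 1, dividing by `ε` and letting `ε ↓ 0` settles `T = I`.
For general `T`, Cauchy–Binet shows that conjugating `A^{[k]}` by `T^{(k)}` gives `(TAT⁻¹)^{[k]}`.
Only `1 ≤ p` is needed. -/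

namespace CompoundMatrix

/-- A function of tuples that changes sign when two slots are exchanged. -/
def IsAlt {ι κ : Type*} [DecidableEq ι] (Z : (ι → κ) → ℝ) : Prop :=
  ∀ (f : ι → κ) (i j : ι), i ≠ j → Z (f ∘ Equiv.swap i j) = -Z f

/-! ### Alternating functions of tuples. -/

section Alternating

variable {ι κ : Type*} [DecidableEq ι] {Z : (ι → κ) → ℝ}

theorem IsAlt.comp_perm [Fintype ι] (hZ : IsAlt Z) (π : Equiv.Perm ι) (f : ι → κ) :
    Z (f ∘ π) = ((Equiv.Perm.sign π : ℤ) : ℝ) * Z f := by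
  induction π using Equiv.Perm.swap_induction_on generalizing f with
  | one => simp
  | swap_mul g x y hxy ih =>
    have : f ∘ ⇑(Equiv.swap x y * g) = (f ∘ Equiv.swap x y) ∘ g := rfl
    rw [this, ih, hZ f x y hxy, Equiv.Perm.sign_mul, Equiv.Perm.sign_swap hxy]
    simp

theorem IsAlt.abs_comp_perm [Fintype ι] (hZ : IsAlt Z) (π : Equiv.Perm ι) (f : ι → κ) :
    |Z (f ∘ π)| = |Z f| := by
  rw [hZ.comp_perm, abs_mul]
  rcases Int.units_eq_one_or (Equiv.Perm.sign π) with h | h <;> simp [h]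

theorem IsAlt.eq_zero (hZ : IsAlt Z) {f : ι → κ} (hf : ¬ Function.Injective f) : Z f = 0 := by
  simp only [Function.Injective, not_forall] at hf
  obtain ⟨i, j, hij, hne⟩ := hf
  have h := hZ f i j hne
  have e : f ∘ Equiv.swap i j = f := by
    ext s
    simp only [Function.comp_apply, Equiv.swap_apply_def]
    split_ifs with h1 h2 <;> simp_all
  rw [e] at h
  linarith

theorem IsAlt.add {W : (ι → κ) → ℝ} (hZ : IsAlt Z) (hW : IsAlt W) : IsAlt (Z + W) := by
  intro f i j h
  simp only [Pi.add_apply, hZ f i j h, hW f i j h]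
  ring

theorem IsAlt.smul (hZ : IsAlt Z) (c : ℝ) : IsAlt (c • Z) := by
  intro f i j h
  simp [hZ f i j h]

theorem isAlt_sum {η : Type*} (s : Finset η) (F : η → (ι → κ) → ℝ) (hF : ∀ i ∈ s, IsAlt (F i)) :
    IsAlt (fun f => ∑ i ∈ s, F i f) := by
  intro f i j h
  rw [← Finset.sum_neg_distrib]
  exact Finset.sum_congr rfl fun a ha => hF a ha f i j h

theorem isAlt_det_submatrix {n m k : ℕ} (A : Matrix (Fin n) (Fin m) ℝ) (g : Fin k → Fin m) :
    IsAlt (fun f : Fin k → Fin n => (A.submatrix f g).det) := by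
  intro f i j h
  have := Matrix.det_permute (Equiv.swap i j) (A.submatrix f g)
  rw [Matrix.submatrix_submatrix, Equiv.Perm.sign_swap h] at this
  simpa using this

end Alternating

/-! ### Increasing tuples and Cauchy–Binet. -/

section Increasing

variable {k n : ℕ}

theorem exists_eq_comp_perm {f : Fin k → Fin n} (hf : Function.Injective f) :
    ∃ (α : Q k n) (π : Equiv.Perm (Fin k)), f = α ∘ π := by
  have hm : StrictMono (f ∘ Tuple.sort f) :=
    (Tuple.monotone_sort f).strictMono_of_injective (hf.comp (Tuple.sort f).injective)
  refine ⟨OrderEmbedding.ofStrictMono _ hm, (Tuple.sort f)⁻¹, ?_⟩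
  ext s
  simp

theorem orderEmb_eq_of_range_subset {α β : Q k n} (h : ∀ i, α i ∈ Set.range β) : α = β := by
  have hs : Set.range α ⊆ Set.range β := by
    rintro _ ⟨i, rfl⟩
    exact h i
  have hc : Set.range α = Set.range β := by
    refine Set.eq_of_subset_of_ncard_le hs ?_ (Set.toFinite _)
    rw [Set.ncard_range_of_injective α.injective, Set.ncard_range_of_injective β.injective]
  exact DFunLike.coe_injective ((StrictMono.range_inj α.strictMono β.strictMono).1 hc)

theorem comp_perm_injective :
    Function.Injective fun x : Q k n × Equiv.Perm (Fin k) => (x.1 : Fin k → Fin n) ∘ x.2 := by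
  rintro ⟨α, π⟩ ⟨β, ρ⟩ h
  simp only at h
  have hαβ : α = β := by
    refine orderEmb_eq_of_range_subset fun i => ?_
    have := congrFun h (π.symm i)
    simp only [Function.comp_apply, Equiv.apply_symm_apply] at this
    exact ⟨_, this.symm⟩
  subst hαβ
  congr 1
  ext i : 1
  exact α.injective (congrFun h i)

/-- An injective tuple is uniquely an increasing one composed with a permutation. -/
theorem sum_eq_sum_increasing (F : (Fin k → Fin n) → ℝ)
    (hF : ∀ f, ¬ Function.Injective f → F f = 0) :
    ∑ f, F f = ∑ α : Q k n, ∑ π : Equiv.Perm (Fin k), F (α ∘ π) := by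
  rw [← Fintype.sum_prod_type' (f := fun (α : Q k n) (π : Equiv.Perm (Fin k)) => F (α ∘ π))]
  symm
  refine Fintype.sum_of_injective _ comp_perm_injective _ _ (fun f hf => hF f fun hi => hf ?_)
    fun _ => rfl
  obtain ⟨α, π, rfl⟩ := exists_eq_comp_perm hi
  exact ⟨(α, π), rfl⟩

theorem IsAlt.ext {Z W : (Fin k → Fin n) → ℝ} (hZ : IsAlt Z) (hW : IsAlt W)
    (h : ∀ α : Q k n, Z α = W α) : Z = W := by
  funext f
  by_cases hf : Function.Injective f
  · obtain ⟨α, π, rfl⟩ := exists_eq_comp_perm hf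
    rw [hZ.comp_perm, hW.comp_perm, h]
  · rw [hZ.eq_zero hf, hW.eq_zero hf]

theorem mulCompound_one : mulCompound k (1 : Matrix (Fin n) (Fin n) ℝ) = 1 := by
  ext α β
  rw [mulCompound, Matrix.of_apply]
  by_cases h : α = β
  · subst h
    rw [Matrix.submatrix_one _ α.injective, Matrix.det_one, Matrix.one_apply_eq]
  · rw [Matrix.one_apply_ne h]
    obtain ⟨i, hi⟩ : ∃ i, α i ∉ Set.range β := by
      by_contra! hc
      exact h (orderEmb_eq_of_range_subset hc)
    refine Matrix.det_eq_zero_of_row_eq_zero i fun j => ?_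
    exact Matrix.one_apply_ne fun e => hi ⟨j, e.symm⟩

/-- The alternating function with prescribed values on increasing sequences. -/
noncomputable def altExtend (y : Q k n → ℝ) (f : Fin k → Fin n) : ℝ :=
  ∑ β : Q k n, ((1 : Matrix (Fin n) (Fin n) ℝ).submatrix f β).det * y β

theorem isAlt_altExtend (y : Q k n → ℝ) : IsAlt (altExtend y) := by
  refine isAlt_sum _ (fun (β : Q k n) f => _) fun β _ => ?_
  intro f i j h
  simp only
  rw [← neg_mul]
  exact congrArg (· * y β) (isAlt_det_submatrix _ _ f i j h)

theorem altExtend_apply (y : Q k n → ℝ) (α : Q k n) : altExtend y α = y α := by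
  have h : ∀ β : Q k n, ((1 : Matrix (Fin n) (Fin n) ℝ).submatrix α β).det
      = (1 : Matrix (Q k n) (Q k n) ℝ) α β := fun β => by
    rw [← mulCompound_one, mulCompound, Matrix.of_apply]
  simp [altExtend, h, Matrix.one_apply]

theorem IsAlt.altExtend_restrict {Z : (Fin k → Fin n) → ℝ} (hZ : IsAlt Z) :
    altExtend (fun α : Q k n => Z α) = Z :=
  (isAlt_altExtend _).ext hZ fun α => altExtend_apply _ α

/-- Each row of the product is a combination of rows of `B`; the determinant is expanded
multilinearly. -/
theorem det_mul_submatrix {a m b : ℕ} (A : Matrix (Fin a) (Fin m) ℝ) (B : Matrix (Fin m) (Fin b) ℝ)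
    (f : Fin k → Fin a) (g : Fin k → Fin b) :
    ((A * B).submatrix f g).det
      = ∑ h : Fin k → Fin m, (∏ i, A (f i) (h i)) * (B.submatrix h g).det := by
  have e : (A * B).submatrix f g
      = fun i => ∑ j : Fin m, A (f i) j • fun s => B j (g s) := by
    ext i s
    simp [Matrix.mul_apply]
  have := (Matrix.detRowAlternating (R := ℝ) (n := Fin k)).toMultilinearMap.map_sum
    (fun i (j : Fin m) => A (f i) j • fun s => B j (g s))
  rw [Matrix.det, e]
  refine this.trans (Finset.sum_congr rfl fun h _ => ?_)
  rw [MultilinearMap.map_smul_univ, smul_eq_mul]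
  rfl

/-- The Cauchy–Binet formula. -/
theorem mulCompound_mul {a m b : ℕ} (A : Matrix (Fin a) (Fin m) ℝ)
    (B : Matrix (Fin m) (Fin b) ℝ) :
    mulCompound k (A * B) = mulCompound k A * mulCompound k B := by
  ext α γ
  -- Minors of `B` alternate in `h`, so they are recovered from increasing tuples; no division by
  -- `k!` is needed.
  have hB : ∀ h : Fin k → Fin m, (B.submatrix h γ).det = ∑ β : Q k m,
      ((1 : Matrix (Fin m) (Fin m) ℝ).submatrix h β).det * (B.submatrix β γ).det := fun h =>
    (congrFun (isAlt_det_submatrix B γ).altExtend_restrict h).symm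
  have hA : ∀ β : Q k m, (A.submatrix α β).det = ∑ h : Fin k → Fin m,
      (∏ i, A (α i) (h i)) * ((1 : Matrix (Fin m) (Fin m) ℝ).submatrix h β).det := fun β => by
    rw [← det_mul_submatrix, Matrix.mul_one]
  simp only [mulCompound, Matrix.of_apply, Matrix.mul_apply]
  rw [det_mul_submatrix]
  rw [Finset.sum_congr rfl fun h _ => by rw [hB h],
    Finset.sum_congr (s₁ := (Finset.univ : Finset (Q k m))) rfl fun β _ => by rw [hA β]]
  simp_rw [Finset.mul_sum, Finset.sum_mul, mul_assoc]
  exact Finset.sum_comm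

end Increasing

/-! ### The additive compound as a derivation. -/

section Derivation

variable {ι κ : Type*} [DecidableEq ι] [Fintype κ]

/-- The sum, over the slots `τ i`, of the action of `B` on that slot. -/
def slotAction {η : Type*} [Fintype η] (B : Matrix κ κ ℝ) (τ : η → ι) (Z : (ι → κ) → ℝ)
    (f : ι → κ) : ℝ :=
  ∑ i, ∑ j, B (f (τ i)) j * Z (Function.update f (τ i) j)

/-- All slots are acted on, so exchanging two slots only permutes the summands. -/
theorem IsAlt.slotAction [Fintype ι] {Z : (ι → κ) → ℝ} (hZ : IsAlt Z) (B : Matrix κ κ ℝ) :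
    IsAlt (slotAction B id Z) := by
  intro f i j h
  simp only [CompoundMatrix.slotAction, id_eq]
  rw [← Finset.sum_neg_distrib, ← Equiv.sum_comp (Equiv.swap i j)]
  refine Finset.sum_congr rfl fun s _ => ?_
  rw [← Finset.sum_neg_distrib]
  refine Finset.sum_congr rfl fun t _ => ?_
  have e : Function.update (f ∘ Equiv.swap i j) (Equiv.swap i j s) t
      = Function.update f s t ∘ Equiv.swap i j := by
    rw [Function.update_comp_equiv, Equiv.symm_swap]
  rw [e, hZ _ i j h, Function.comp_apply, Equiv.swap_apply_self, mul_neg]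

/-- The determinant is differentiated one row at a time, and the row of `B` that appears is expanded
in rows of the identity. -/
theorem addCompound_apply {k n : ℕ} (B : Matrix (Fin n) (Fin n) ℝ) (α β : Q k n) :
    addCompound k B α β = ∑ s, ∑ j, B (α s) j *
      ((1 : Matrix (Fin n) (Fin n) ℝ).submatrix (Function.update α s j) β).det := by
  refine (hasDerivAt_mulCompound k B α β).unique ?_
  let D : ContinuousMultilinearMap ℝ (fun _ : Fin k => Fin k → ℝ) ℝ :=
    ⟨(Matrix.detRowAlternating (R := ℝ) (n := Fin k)).toMultilinearMap,
      (continuous_id (X := Matrix (Fin k) (Fin k) ℝ)).matrix_det⟩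
  have hD : ∀ M : Fin k → Fin k → ℝ, D M = Matrix.det (Matrix.of M) := fun M => rfl
  have hpath : HasDerivAt (fun (ε : ℝ) (i s : Fin k) => (1 + ε • B) (α i) (β s))
      (fun i s => B (α i) (β s)) 0 := by
    refine hasDerivAt_pi.2 fun i => hasDerivAt_pi.2 fun s => ?_
    simpa using ((hasDerivAt_id (0 : ℝ)).mul_const (B (α i) (β s))).const_add
      ((1 : Matrix (Fin n) (Fin n) ℝ) (α i) (β s))
  have hcomp := (D.hasFDerivAt (x := fun i s => (1 + (0 : ℝ) • B) (α i) (β s))).comp_hasDerivAt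
    (0 : ℝ) hpath
  refine (hcomp.congr_deriv ?_ :)
  rw [ContinuousMultilinearMap.linearDeriv_apply]
  refine Finset.sum_congr rfl fun s _ => ?_
  have e : (fun t => B (α s) (β t)) = ∑ j, B (α s) j •
      fun t => (1 : Matrix (Fin n) (Fin n) ℝ) j (β t) := by
    ext t
    simp [Matrix.one_apply]
  rw [e]
  refine (D.toMultilinearMap.map_update_sum _ _ _ _).trans (Finset.sum_congr rfl fun j _ => ?_)
  rw [MultilinearMap.map_update_smul, smul_eq_mul]
  refine congrArg _ ((hD _).trans ?_)
  congr 1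
  ext i t
  by_cases h : i = s
  · subst h
    simp only [Matrix.of_apply, Matrix.submatrix_apply]
    rw [Function.update_self, Function.update_self]
  · simp only [Matrix.of_apply, Matrix.submatrix_apply]
    rw [Function.update_of_ne h, Function.update_of_ne h, zero_smul, add_zero]

theorem addCompound_mulVec {k n : ℕ} {Z : (Fin k → Fin n) → ℝ} (hZ : IsAlt Z)
    (B : Matrix (Fin n) (Fin n) ℝ) (α : Q k n) :
    (addCompound k B).mulVec (fun β : Q k n => Z β) α = slotAction B id Z α := by
  conv_rhs => rw [← hZ.altExtend_restrict]
  simp only [Matrix.mulVec, dotProduct, addCompound_apply, slotAction, altExtend, id_eq,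
    Finset.mul_sum, Finset.sum_mul]
  rw [Finset.sum_comm]
  refine Finset.sum_congr rfl fun s _ => ?_
  rw [Finset.sum_comm]
  exact Finset.sum_congr rfl fun j _ => Finset.sum_congr rfl fun β _ => mul_assoc _ _ _

end Derivation

/-! ### `L_p` norms of alternating functions. -/

section LpNorm

variable {ι κ : Type*} [Fintype ι] [Fintype κ]

theorem lpNorm_eq_sum {p : ℝ≥0∞} (hp : 0 < p.toReal) (x : ι → ℝ) :
    lpNorm p x = (∑ i, |x i| ^ p.toReal) ^ (1 / p.toReal) := by
  rw [lpNorm, PiLp.norm_eq_sum hp]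
  simp

theorem lpNorm_top (x : ι → ℝ) : lpNorm ∞ x = ⨆ i, |x i| := by
  rw [lpNorm, PiLp.norm_eq_ciSup]
  simp

theorem abs_le_lpNorm_top (x : ι → ℝ) (i : ι) : |x i| ≤ lpNorm ∞ x := by
  rw [lpNorm_top]
  exact le_ciSup (f := fun i => |x i|) (Set.finite_range _).bddAbove i

theorem lpNorm_top_le {x : ι → ℝ} {c : ℝ} (hc : 0 ≤ c) (h : ∀ i, |x i| ≤ c) :
    lpNorm ∞ x ≤ c := by
  rw [lpNorm_top]
  exact Real.iSup_le h hc

section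

variable (p : ℝ≥0∞) [Fact (1 ≤ p)]

theorem lpNorm_nonneg (x : ι → ℝ) : 0 ≤ lpNorm p x := norm_nonneg _

theorem lpNorm_smul (c : ℝ) (x : ι → ℝ) : lpNorm p (c • x) = |c| * lpNorm p x := by
  simp only [lpNorm, WithLp.toLp_smul, norm_smul, Real.norm_eq_abs]

theorem lpNorm_eq_zero {x : ι → ℝ} : lpNorm p x = 0 ↔ x = 0 := by
  rw [lpNorm, norm_eq_zero, WithLp.toLp_eq_zero]

theorem lpNorm_sum_le {η : Type*} (s : Finset η) (F : η → ι → ℝ) :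
    lpNorm p (∑ r ∈ s, F r) ≤ ∑ r ∈ s, lpNorm p (F r) := by
  simp only [lpNorm, WithLp.toLp_sum]
  exact norm_sum_le _ _

theorem lpNorm_comp_equiv (e : κ ≃ ι) (x : ι → ℝ) : lpNorm p (x ∘ e) = lpNorm p x := by
  rw [lpNorm, ← (LinearIsometryEquiv.piLpCongrLeft p ℝ ℝ e).norm_map
    (WithLp.toLp p (x ∘ e)), lpNorm]
  congr 1
  ext i
  simp [LinearIsometryEquiv.piLpCongrLeft_apply]

theorem toReal_pos_of_ne_top {p : ℝ≥0∞} [h : Fact (1 ≤ p)] (hp : p ≠ ∞) : 0 < p.toReal :=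
  ENNReal.toReal_pos (one_pos.trans_le h.out).ne' hp

theorem lpNorm_rpow (hp : p ≠ ∞) (x : ι → ℝ) :
    lpNorm p x ^ p.toReal = ∑ i, |x i| ^ p.toReal := by
  have h := toReal_pos_of_ne_top hp
  rw [lpNorm_eq_sum h, ← Real.rpow_mul (by positivity), one_div_mul_cancel h.ne', Real.rpow_one]

/-- A bound on the norms of all slices is a bound on the norm. -/
theorem lpNorm_le_of_slices {x y : ι × κ → ℝ} {c : ℝ} (hc : 0 ≤ c)
    (h : ∀ b, lpNorm p (fun a => x (a, b)) ≤ c * lpNorm p (fun a => y (a, b))) :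
    lpNorm p x ≤ c * lpNorm p y := by
  by_cases hp : p = ∞
  · subst hp
    refine lpNorm_top_le (mul_nonneg hc (lpNorm_nonneg _ _)) fun ⟨a, b⟩ => ?_
    refine (abs_le_lpNorm_top (fun a => x (a, b)) a).trans ((h b).trans ?_)
    refine mul_le_mul_of_nonneg_left ?_ hc
    exact lpNorm_top_le (lpNorm_nonneg _ _) fun a => abs_le_lpNorm_top y (a, b)
  · have hpos := toReal_pos_of_ne_top hp
    refine (Real.rpow_le_rpow_iff (lpNorm_nonneg _ _) (mul_nonneg hc (lpNorm_nonneg _ _)) hpos).1 ?_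
    rw [Real.mul_rpow hc (lpNorm_nonneg _ _), lpNorm_rpow p hp, lpNorm_rpow p hp,
      Fintype.sum_prod_type_right, Fintype.sum_prod_type_right, Finset.mul_sum]
    refine Finset.sum_le_sum fun b _ => ?_
    have := Real.rpow_le_rpow (lpNorm_nonneg _ _) (h b) hpos.le
    rwa [Real.mul_rpow hc (lpNorm_nonneg _ _), lpNorm_rpow p hp, lpNorm_rpow p hp] at this

/-- The norm of an alternating function is a fixed multiple of the norm of its restriction to
increasing sequences. -/
theorem exists_lpNorm_alt_eq (k n : ℕ) : ∃ C : ℝ, 0 < C ∧ ∀ Z : (Fin k → Fin n) → ℝ, IsAlt Z →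
    lpNorm p Z = C * lpNorm p (fun α : Q k n => Z α) := by
  by_cases hp : p = ∞
  · subst hp
    refine ⟨1, one_pos, fun Z hZ => ?_⟩
    rw [one_mul]
    refine le_antisymm (lpNorm_top_le (lpNorm_nonneg _ _) fun f => ?_)
      (lpNorm_top_le (lpNorm_nonneg _ _) fun α => abs_le_lpNorm_top Z α)
    by_cases hf : Function.Injective f
    · obtain ⟨α, π, rfl⟩ := exists_eq_comp_perm hf
      rw [hZ.abs_comp_perm]
      exact abs_le_lpNorm_top (fun α : Q k n => Z α) α
    · rw [hZ.eq_zero hf, abs_zero]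
      exact lpNorm_nonneg _ _
  · have hpos := toReal_pos_of_ne_top hp
    -- Each increasing tuple has `k!` rearrangements with the same `|Z|`, and `Z` vanishes on
    -- non-injective tuples.
    refine ⟨(k.factorial : ℝ) ^ (1 / p.toReal), by positivity, fun Z hZ => ?_⟩
    rw [lpNorm_eq_sum hpos, lpNorm_eq_sum hpos, ← Real.mul_rpow (by positivity) (by positivity),
      sum_eq_sum_increasing _ fun f hf => by
        rw [hZ.eq_zero hf, abs_zero, Real.zero_rpow hpos.ne'], Finset.mul_sum]
    simp [hZ.abs_comp_perm, Fintype.card_perm]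

end

end LpNorm

/-! ### Induced and logarithmic norms under change of coordinates. -/

section InducedNorm

variable {ι : Type*} [Fintype ι] (p : ℝ≥0∞)

theorem inducedNorm_le {M : Matrix ι ι ℝ} {c : ℝ} (hc : 0 ≤ c)
    (h : ∀ x, lpNorm p (M.mulVec x) ≤ c * lpNorm p x) : inducedNorm (lpNorm p) M ≤ c := by
  refine Real.sSup_le ?_ hc
  rintro _ ⟨x, hx, rfl⟩
  have := h x
  rwa [show lpNorm p x = 1 from hx, mul_one] at this

section

variable [Fact (1 ≤ p)]

theorem bddAbove_lpNorm_mulVec (M : Matrix ι ι ℝ) :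
    BddAbove ((fun x => lpNorm p (M.mulVec x)) '' {x | lpNorm p x = 1}) := by
  let L : WithLp p (ι → ℝ) →ₗ[ℝ] WithLp p (ι → ℝ) :=
    (WithLp.linearEquiv p ℝ (ι → ℝ)).symm.toLinearMap ∘ₗ
      M.mulVecLin ∘ₗ (WithLp.linearEquiv p ℝ (ι → ℝ)).toLinearMap
  refine ⟨‖LinearMap.toContinuousLinearMap L‖, ?_⟩
  rintro _ ⟨x, hx, rfl⟩
  have h := (LinearMap.toContinuousLinearMap L).le_opNorm (WithLp.toLp p x)
  have hx' : ‖WithLp.toLp p x‖ = 1 := hx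
  rwa [hx', mul_one] at h

theorem inducedNorm_nonneg (M : Matrix ι ι ℝ) : 0 ≤ inducedNorm (lpNorm p) M := by
  refine Real.sSup_nonneg ?_
  rintro _ ⟨x, -, rfl⟩
  exact lpNorm_nonneg _ _

theorem lpNorm_mulVec_le (M : Matrix ι ι ℝ) (x : ι → ℝ) :
    lpNorm p (M.mulVec x) ≤ inducedNorm (lpNorm p) M * lpNorm p x := by
  by_cases hx : lpNorm p x = 0
  · rw [(lpNorm_eq_zero p).1 hx, Matrix.mulVec_zero, (lpNorm_eq_zero p).2 rfl, mul_zero]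
  · have hpos : 0 < lpNorm p x := lt_of_le_of_ne (lpNorm_nonneg _ _) (Ne.symm hx)
    have h := le_csSup (bddAbove_lpNorm_mulVec p M)
      ⟨(lpNorm p x)⁻¹ • x, by
        rw [Set.mem_ofPred_eq, lpNorm_smul, abs_of_pos (inv_pos.2 hpos), inv_mul_cancel₀ hx], rfl⟩
    simp only [Matrix.mulVec_smul] at h
    rw [lpNorm_smul, abs_of_pos (inv_pos.2 hpos), inv_mul_le_iff₀ hpos, mul_comm] at h
    exact h

end

variable [DecidableEq ι]

theorem inducedNorm_scaledNorm (N : (ι → ℝ) → ℝ) {T : Matrix ι ι ℝ} (hT : IsUnit T)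
    (M : Matrix ι ι ℝ) :
    inducedNorm (scaledNorm N T) M = inducedNorm N (T * M * T⁻¹) := by
  have hdet : IsUnit T.det := (Matrix.isUnit_iff_isUnit_det T).1 hT
  unfold inducedNorm scaledNorm
  congr 1
  ext r
  constructor
  · rintro ⟨x, hx, rfl⟩
    refine ⟨T.mulVec x, hx, ?_⟩
    simp only [Matrix.mulVec_mulVec]
    rw [Matrix.mul_assoc, Matrix.nonsing_inv_mul _ hdet, Matrix.mul_one]
  · rintro ⟨x, hx, rfl⟩
    refine ⟨T⁻¹.mulVec x, ?_, ?_⟩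
    · rw [Set.mem_ofPred_eq, Matrix.mulVec_mulVec, Matrix.mul_nonsing_inv _ hdet,
        Matrix.one_mulVec]
      exact hx
    · simp only [Matrix.mulVec_mulVec, Matrix.mul_assoc]

theorem logNormLp_eq_one {T : Matrix ι ι ℝ} (hT : IsUnit T) (A : Matrix ι ι ℝ) :
    logNormLp p T A = logNormLp p 1 (T * A * T⁻¹) := by
  have hdet : IsUnit T.det := (Matrix.isUnit_iff_isUnit_det T).1 hT
  unfold logNormLp logNorm
  congr 1
  ext ε
  rw [inducedNorm_scaledNorm _ hT, inducedNorm_scaledNorm _ isUnit_one]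
  simp [Matrix.mul_add, Matrix.add_mul, Matrix.mul_nonsing_inv _ hdet]

theorem tendsto_logNormLp_one [Fact (1 ≤ p)] [Nonempty ι] (A : Matrix ι ι ℝ) :
    Tendsto (fun ε : ℝ => (inducedNorm (lpNorm p) (1 + ε • A) - 1) / ε)
      (𝓝[>] (0 : ℝ)) (𝓝 (logNormLp p 1 A)) := by
  have h := tendsto_logNormLp p Fact.out 1 A isUnit_one
  simpa [inducedNorm_scaledNorm _ isUnit_one] using h

theorem logNormLp_submatrix_equiv [Fact (1 ≤ p)] {κ : Type*} [Fintype κ] [DecidableEq κ] (e : κ ≃ ι)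
    (T A : Matrix ι ι ℝ) :
    logNormLp p (T.submatrix e e) (A.submatrix e e) = logNormLp p T A := by
  unfold logNormLp logNorm
  congr 1
  ext ε
  congr 2
  have hone : (1 : Matrix κ κ ℝ) + ε • A.submatrix e e = (1 + ε • A).submatrix e e := by
    ext i j
    simp [Matrix.one_apply]
  rw [hone]
  have key : ∀ (M : Matrix ι ι ℝ) (x : ι → ℝ), (M.submatrix e e).mulVec (x ∘ e)
      = M.mulVec x ∘ e := fun M x => by
    rw [Matrix.submatrix_mulVec_equiv]
    simp [Function.comp_assoc]
  have hN : ∀ x : ι → ℝ, scaledNorm (lpNorm p) (T.submatrix e e) (x ∘ e)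
      = scaledNorm (lpNorm p) T x := fun x => by
    rw [scaledNorm, key, lpNorm_comp_equiv, scaledNorm]
  unfold inducedNorm
  congr 1
  ext r
  constructor
  · rintro ⟨x, hx, rfl⟩
    obtain ⟨y, rfl⟩ : ∃ y : ι → ℝ, x = y ∘ e := ⟨x ∘ e.symm, by simp [Function.comp_assoc]⟩
    refine ⟨y, (hN y).symm.trans hx, ?_⟩
    simp only [key, hN]
  · rintro ⟨y, hy, rfl⟩
    refine ⟨y ∘ e, (hN y).trans hy, ?_⟩
    simp only [key, hN]

end InducedNorm

/-! ### Monotonicity in the order of the compound, unscaled case. -/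

section Monotonicity

variable (p : ℝ≥0∞) [Fact (1 ≤ p)] {n : ℕ}

/-- Acting on only some of the slots of an alternating function increases its norm at most by the
norm of the corresponding compound. -/
theorem lpNorm_add_smul_slotAction_le {k ℓ m : ℕ} (E : Fin ℓ ⊕ Fin m ≃ Fin k)
    {Z : (Fin k → Fin n) → ℝ} (hZ : IsAlt Z) (B : Matrix (Fin n) (Fin n) ℝ) (ε : ℝ) :
    lpNorm p (Z + ε • slotAction B (fun i => E (Sum.inl i)) Z)
      ≤ inducedNorm (lpNorm p) (1 + ε • addCompound ℓ B) * lpNorm p Z := by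
  -- Splits a tuple into its `ℓ` active entries and its `m` frozen ones.
  let Φ : (Fin ℓ → Fin n) × (Fin m → Fin n) ≃ (Fin k → Fin n) :=
    (Equiv.sumArrowEquivProdArrow _ _ _).symm.trans (Equiv.arrowCongr E (Equiv.refl _))
  have hΦ : ∀ h g, Φ (h, g) = Sum.elim h g ∘ E.symm := fun h g => rfl
  have hinl : ∀ h g i, Φ (h, g) (E (Sum.inl i)) = h i := fun h g i => by simp [hΦ]
  have hupd : ∀ h g i j, Function.update (Φ (h, g)) (E (Sum.inl i)) j
      = Φ (Function.update h i j, g) := fun h g i j => by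
    rw [hΦ, hΦ, Sum.elim_update_left, Function.update_comp_equiv, Equiv.symm_symm]
  rw [← lpNorm_comp_equiv p Φ, ← lpNorm_comp_equiv p Φ Z]
  refine lpNorm_le_of_slices p (inducedNorm_nonneg p _) fun g => ?_
  set Y : (Fin ℓ → Fin n) → ℝ := fun h => Z (Φ (h, g)) with hY
  have hYalt : IsAlt Y := by
    intro h i j hij
    have e : Φ (h ∘ Equiv.swap i j, g)
        = Φ (h, g) ∘ Equiv.swap (E (Sum.inl i)) (E (Sum.inl j)) := by
      ext s
      obtain ⟨x, rfl⟩ := E.surjective s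
      rw [Function.comp_apply, ← E.injective.map_swap, hΦ, hΦ]
      simp only [Function.comp_apply, Equiv.symm_apply_apply]
      rcases x with a | a
      · rw [← Sum.inl_injective.map_swap, Sum.elim_inl, Sum.elim_inl, Function.comp_apply]
      · rw [Equiv.swap_apply_of_ne_of_ne (by simp) (by simp), Sum.elim_inr, Sum.elim_inr]
    simp only [hY, e]
    exact hZ _ _ _ fun he => hij (Sum.inl_injective (E.injective he))
  have hslice : (fun h => ((Z + ε • slotAction B (fun i => E (Sum.inl i)) Z) ∘ Φ) (h, g))
      = Y + ε • slotAction B id Y := by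
    ext h
    simp [slotAction, hinl, hupd, hY]
  obtain ⟨C, hC, hCZ⟩ := exists_lpNorm_alt_eq p ℓ n
  change lpNorm p _ ≤ _ * lpNorm p Y
  rw [hslice, hCZ _ hYalt, hCZ _ (hYalt.add ((hYalt.slotAction B).smul ε)), mul_left_comm]
  refine mul_le_mul_of_nonneg_left ?_ hC.le
  refine le_trans (le_of_eq ?_) (lpNorm_mulVec_le p _ _)
  congr 1
  ext α
  simp [Matrix.add_mulVec, Matrix.smul_mulVec, addCompound_mulVec hYalt]

theorem inducedNorm_addCompound_le {k ℓ : ℕ} (hℓ : 1 ≤ ℓ) (hℓk : ℓ ≤ k)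
    (B : Matrix (Fin n) (Fin n) ℝ) (ε : ℝ) :
    inducedNorm (lpNorm p) (1 + ((ℓ : ℝ) / k * ε) • addCompound k B)
      ≤ inducedNorm (lpNorm p) (1 + ε • addCompound ℓ B) := by
  obtain ⟨m, rfl⟩ := Nat.exists_eq_add_of_le hℓk
  have : NeZero (ℓ + m) := ⟨by omega⟩
  have hk : ((ℓ + m : ℕ) : ℝ) ≠ 0 := Nat.cast_ne_zero.2 (NeZero.ne _)
  refine inducedNorm_le p (inducedNorm_nonneg p _) fun y => ?_
  obtain ⟨C, hC, hCZ⟩ := exists_lpNorm_alt_eq p (ℓ + m) n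
  have hZ := isAlt_altExtend y
  have hy : (fun α : Q (ℓ + m) n => altExtend y α) = y := funext (altExtend_apply y)
  set Z := altExtend y
  set c := inducedNorm (lpNorm p) (1 + ε • addCompound ℓ B)
  -- The active slots are the first `ℓ`, shifted cyclically by `r`.
  let E : Fin (ℓ + m) → Fin ℓ ⊕ Fin m ≃ Fin (ℓ + m) := fun r =>
    finSumFinEquiv.trans (Equiv.addLeft r)
  let W : Fin (ℓ + m) → (Fin (ℓ + m) → Fin n) → ℝ := fun r =>
    Z + ε • slotAction B (fun i => E r (Sum.inl i)) Z
  have hsum : ∑ r, slotAction B (fun i => E r (Sum.inl i)) Z = (ℓ : ℝ) • slotAction B id Z := by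
    ext f
    simp only [slotAction, Finset.sum_apply, Pi.smul_apply, smul_eq_mul, id_eq]
    rw [Finset.sum_comm]
    -- For fixed `i`, the shifted slot runs once through all slots as `r` varies; the `ℓ` values of
    -- `i` give the factor `ℓ`.
    have h : ∀ i : Fin ℓ, ∑ r, ∑ j, B (f (E r (Sum.inl i))) j *
        Z (Function.update f (E r (Sum.inl i)) j)
        = ∑ s, ∑ j, B (f s) j * Z (Function.update f s j) := fun i =>
      Equiv.sum_comp (Equiv.addRight (finSumFinEquiv (Sum.inl i)))
        fun s => ∑ j, B (f s) j * Z (Function.update f s j)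
    rw [Finset.sum_congr rfl fun i _ => h i]
    simp
  have hW : Z + ((ℓ : ℝ) / (ℓ + m : ℕ) * ε) • slotAction B id Z
      = ((ℓ + m : ℕ) : ℝ)⁻¹ • ∑ r, W r := by
    simp only [W, Finset.sum_add_distrib, ← Finset.smul_sum, hsum]
    rw [Finset.sum_const, Finset.card_univ, Fintype.card_fin, smul_add, ← Nat.cast_smul_eq_nsmul ℝ,
      smul_smul, inv_mul_cancel₀ hk, one_smul, smul_smul, smul_smul]
    congr 2
    ring
  have hle : lpNorm p (Z + ((ℓ : ℝ) / (ℓ + m : ℕ) * ε) • slotAction B id Z) ≤ c * lpNorm p Z := by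
    rw [hW, lpNorm_smul, abs_of_nonneg (by positivity), inv_mul_le_iff₀ (by positivity)]
    refine (lpNorm_sum_le p _ _).trans ?_
    refine (Finset.sum_le_card_nsmul _ _ _ fun r _ =>
      lpNorm_add_smul_slotAction_le p (E r) hZ B ε).trans (le_of_eq ?_)
    rw [Finset.card_univ, Fintype.card_fin, nsmul_eq_mul]
  rw [hCZ _ hZ, hCZ _ (hZ.add ((hZ.slotAction B).smul _)), mul_left_comm, hy] at hle
  refine le_trans (le_of_eq ?_) (le_of_mul_le_mul_left hle hC)
  congr 1
  ext α
  rw [Matrix.add_mulVec, Matrix.smul_mulVec, Matrix.one_mulVec]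
  have h1 := addCompound_mulVec hZ B α
  have h2 := congrFun hy α
  rw [hy] at h1
  simp only [Pi.add_apply, Pi.smul_apply, h1, h2]

/-- Over an empty index set the unit sphere is empty, the induced norm defaults to 0, and the
logarithmic norm's limit does not exist. -/
theorem nonempty_Q {k n : ℕ} (h : k ≤ n) : Nonempty (Q k n) := ⟨Fin.castLEOrderEmb h⟩

theorem mul_logNormLp_one_addCompound_le {k ℓ : ℕ} (hℓ : 1 ≤ ℓ) (hℓk : ℓ ≤ k) (hkn : k ≤ n)
    (B : Matrix (Fin n) (Fin n) ℝ) :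
    (ℓ : ℝ) / k * logNormLp p 1 (addCompound k B) ≤ logNormLp p 1 (addCompound ℓ B) := by
  have := nonempty_Q hkn
  have := nonempty_Q (hℓk.trans hkn)
  have hℓ' : (0 : ℝ) < ℓ := by exact_mod_cast hℓ
  have hk' : (0 : ℝ) < k := by exact_mod_cast hℓ.trans hℓk
  have ha : (0 : ℝ) < (ℓ : ℝ) / k := by positivity
  -- Running the limit for `k` along `(ℓ/k)ε` makes the two numerators comparable and produces the
  -- factor `ℓ/k`.
  have hscale : Tendsto (fun ε : ℝ => (ℓ : ℝ) / k * ε) (𝓝[>] 0) (𝓝[>] 0) := by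
    refine tendsto_nhdsWithin_iff.2 ⟨?_, ?_⟩
    · refine tendsto_nhdsWithin_of_tendsto_nhds ?_
      simpa using (tendsto_id (α := ℝ) (x := 𝓝 0)).const_mul ((ℓ : ℝ) / k)
    · filter_upwards [self_mem_nhdsWithin] with ε hε
      exact mul_pos ha hε
  refine le_of_tendsto_of_tendsto
    (((tendsto_logNormLp_one p (addCompound k B)).comp hscale).const_mul ((ℓ : ℝ) / k))
    (tendsto_logNormLp_one p (addCompound ℓ B)) ?_
  filter_upwards [self_mem_nhdsWithin] with ε hε
  have hε' : (0 : ℝ) < ε := hε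
  rw [Function.comp_apply, mul_div_assoc', mul_div_mul_left _ _ ha.ne']
  gcongr
  exact inducedNorm_addCompound_le p hℓ hℓk B ε

end Monotonicity

/-! ### Reduction to the unscaled norm, and compounds of order one. -/

section Scaling

variable {k n : ℕ}

theorem isUnit_mulCompound {T : Matrix (Fin n) (Fin n) ℝ} (hT : IsUnit T) :
    IsUnit (mulCompound k T) := by
  have hdet : IsUnit T.det := (Matrix.isUnit_iff_isUnit_det T).1 hT
  refine IsUnit.of_mul_eq_one (mulCompound k T⁻¹) ?_
  rw [← mulCompound_mul, Matrix.mul_nonsing_inv _ hdet, mulCompound_one]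

/-- Derivative at 0 of `T^{(k)}(I + εA)^{(k)} = (I + εB)^{(k)}T^{(k)}`, which is Cauchy–Binet. -/
theorem mulCompound_mul_addCompound {T A B : Matrix (Fin n) (Fin n) ℝ} (h : T * A = B * T) :
    mulCompound k T * addCompound k A = addCompound k B * mulCompound k T := by
  ext α β
  rw [Matrix.mul_apply, Matrix.mul_apply]
  refine (HasDerivAt.fun_sum fun γ _ =>
    (hasDerivAt_mulCompound k A γ β).const_mul (mulCompound k T α γ)).unique ?_
  refine (HasDerivAt.fun_sum fun γ _ =>
    (hasDerivAt_mulCompound k B α γ).mul_const (mulCompound k T γ β)).congr_of_eventuallyEq ?_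
  refine Eventually.of_forall fun ε => ?_
  simp only [← Matrix.mul_apply]
  rw [← mulCompound_mul, ← mulCompound_mul]
  simp [Matrix.mul_add, Matrix.add_mul, h]

theorem logNormLp_addCompound (p : ℝ≥0∞) {T : Matrix (Fin n) (Fin n) ℝ} (hT : IsUnit T)
    (A : Matrix (Fin n) (Fin n) ℝ) :
    logNormLp p (mulCompound k T) (addCompound k A)
      = logNormLp p 1 (addCompound k (T * A * T⁻¹)) := by
  have hdet : IsUnit T.det := (Matrix.isUnit_iff_isUnit_det T).1 hT
  have hU := isUnit_mulCompound (k := k) hT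
  rw [logNormLp_eq_one p hU, mulCompound_mul_addCompound (B := T * A * T⁻¹), Matrix.mul_assoc,
    Matrix.mul_nonsing_inv _ ((Matrix.isUnit_iff_isUnit_det _).1 hU), Matrix.mul_one]
  rw [Matrix.mul_assoc, Matrix.nonsing_inv_mul _ hdet, Matrix.mul_one]

/-- Increasing sequences of length one are elements. -/
def oneEquiv (n : ℕ) : Q 1 n ≃ Fin n where
  toFun α := α 0
  invFun i := OrderEmbedding.ofStrictMono (fun _ => i) (Subsingleton.strictMono _)
  left_inv α := by
    ext s
    rw [Subsingleton.elim s 0]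
    rfl
  right_inv i := rfl

theorem mulCompound_one_eq_submatrix (T : Matrix (Fin n) (Fin n) ℝ) :
    mulCompound 1 T = T.submatrix (oneEquiv n) (oneEquiv n) := by
  ext α β
  simp only [mulCompound, Matrix.of_apply, Matrix.det_unique]
  rfl

theorem addCompound_one_eq_submatrix (A : Matrix (Fin n) (Fin n) ℝ) :
    addCompound 1 A = A.submatrix (oneEquiv n) (oneEquiv n) := by
  ext α β
  refine (hasDerivAt_mulCompound 1 A α β).unique ?_
  simp only [mulCompound_one_eq_submatrix, Matrix.submatrix_apply, Matrix.add_apply,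
    Matrix.smul_apply, smul_eq_mul]
  simpa using ((hasDerivAt_id (0 : ℝ)).mul_const (A (oneEquiv n α) (oneEquiv n β))).const_add
    ((1 : Matrix (Fin n) (Fin n) ℝ) (oneEquiv n α) (oneEquiv n β))

end Scaling

end CompoundMatrix

theorem mainTheorem4 (n : ℕ) (A T : Matrix (Fin n) (Fin n) ℝ) (hT : IsUnit T)
    (p : ℝ≥0∞) (hp : p = 1 ∨ p = 2 ∨ p = ∞) (k ℓ : ℕ) (hℓ : 1 ≤ ℓ) (hℓk : ℓ ≤ k) (hkn : k ≤ n) :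
    (1 / (k : ℝ)) * logNormLp p (mulCompound k T) (addCompound k A)
        ≤ (1 / (ℓ : ℝ)) * logNormLp p (mulCompound ℓ T) (addCompound ℓ A) ∧
      logNormLp p (mulCompound k T) (addCompound k A) ≤ (k : ℝ) * logNormLp p T A := by
  have : Fact (1 ≤ p) := ⟨by rcases hp with rfl | rfl | rfl <;> simp⟩
  have key : ∀ r : ℕ, 1 ≤ r → r ≤ k →
      (1 / (k : ℝ)) * logNormLp p (mulCompound k T) (addCompound k A)
        ≤ (1 / (r : ℝ)) * logNormLp p (mulCompound r T) (addCompound r A) := by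
    intro r hr hrk
    have hr' : (0 : ℝ) < r := by exact_mod_cast hr
    have h := mul_logNormLp_one_addCompound_le p hr hrk hkn (T * A * T⁻¹)
    rw [← logNormLp_addCompound p hT, ← logNormLp_addCompound p hT] at h
    rw [one_div_mul_eq_div (r : ℝ), le_div_iff₀ hr']
    calc _ = (r : ℝ) / k * logNormLp p (mulCompound k T) (addCompound k A) := by ring
      _ ≤ _ := h
  refine ⟨key ℓ hℓ hℓk, ?_⟩
  have hk' : (0 : ℝ) < k := by exact_mod_cast hℓ.trans hℓk
  -- First compounds are the matrices themselves, relabelled along `Q 1 n ≃ Fin n`.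
  have h := key 1 le_rfl (hℓ.trans hℓk)
  rw [mulCompound_one_eq_submatrix, addCompound_one_eq_submatrix, logNormLp_submatrix_equiv,
    Nat.cast_one, one_div_one, one_mul, one_div_mul_eq_div, div_le_iff₀' hk'] at h
  exact h
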